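/- For an infinite sequence of real-valued random variables $(X_1,X_2,\ldots)$ let $K_3=\#\{X_1,X_2,X_3\}$ be the number of distinct values among the first three terms, and identify the law of $K_3$ with the vector $(\mathbb P(K_3=1),\mathbb P(K_3=2),\mathbb P(K_3=3))\in\mathbb R^3$. For $m=1,2,\ldots$ let $v_{3,m}$ be the law of the number of distinct values among three i.i.d. samples from the uniform distribution on $m$ elements, let $v_{3,\infty}=(0,0,1)$, and let $V_3=\{v_{3,m}: m=1,2,\ldots,\infty\}$. The sequence $(X_1,X_2,\ldots)$ is called exchangeable if its joint distribution is invariant under all permutations of the indices that move only finitely many of them. Then: (i) The set of extreme points of the convex hull $\operatorname{conv}(V_3)$ is $V_3$. (ii) The set of all laws of $K_3$, as $(X_1,X_2,\ldots)$ ranges over all infinite exchangeable sequences of real-valued random variables (on arbitrary probability spaces), is $\operatorname{conv}(V_3)$. -/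

import Mathlib

open MeasureTheory ProbabilityTheory

universe u

/-- The number of distinct values among the entries of a finite sequence `x 0, …, x (n - 1)`. -/
noncomputable def numDistinct {α : Type*} {n : ℕ} (x : Fin n → α) : ℕ :=
  (Set.range x).ncard

/-- The law of the number `K` of distinct values among the random variables
`X 0, …, X (n - 1)`, as the vector `(P(K = 1), …, P(K = n))`: the entry with index
`k : Fin n` is `P(K = k + 1)`. -/
noncomputable def lawNumDistinct {Ω α : Type*} [MeasurableSpace Ω] {n : ℕ}
    (P : Measure Ω) (X : Fin n → Ω → α) : Fin n → ℝ :=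
  fun k => P.real {ω | numDistinct (fun i => X i ω) = (k : ℕ) + 1}

/-- The law of the number of distinct values among `n` i.i.d. samples from the uniform
distribution on `m` elements. -/
noncomputable def uniformLaw (n m : ℕ) : Fin n → ℝ :=
  lawNumDistinct (Measure.pi fun _ : Fin n => uniformOn (Set.univ : Set (Fin m)))
    (fun i x => x i)

/-- The vector `(0, …, 0, 1)`. -/
def limitLaw (n : ℕ) : Fin n → ℝ :=
  fun k => if (k : ℕ) + 1 = n then 1 else 0

/-- The uniform laws for `m = 1, 2, …`, together with `(0, …, 0, 1)`. -/
def lawVertices (n : ℕ) : Set (Fin n → ℝ) :=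
  {v | ∃ m : ℕ, 1 ≤ m ∧ v = uniformLaw n m} ∪ {limitLaw n}

/-- An infinite sequence of real random variables is exchangeable if its joint law is invariant
under every permutation of the indices that moves only finitely many of them. -/
def IsExchangeable {Ω : Type*} [MeasurableSpace Ω] (P : Measure Ω) (X : ℕ → Ω → ℝ) : Prop :=
  ∀ σ : Equiv.Perm ℕ, {i | σ i ≠ i}.Finite →
    P.map (fun ω i => X (σ i) ω) = P.map (fun ω i => X i ω)

/-- The set of laws of the number of distinct values among the first `n` terms of an infinite
exchangeable sequence of real random variables, on an arbitrary probability space. -/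
def exchangeableLaws (n : ℕ) : Set (Fin n → ℝ) :=
  {a | ∃ (Ω : Type u) (_ : MeasurableSpace Ω) (P : Measure Ω) (X : ℕ → Ω → ℝ),
    IsProbabilityMeasure P ∧ (∀ i, Measurable (X i)) ∧ IsExchangeable P X ∧
      a = lawNumDistinct P (fun i : Fin n => X i)}

/-! For exchangeable variables the law of `K₃` is an affine function (`tripleLaw`) of `s`, the
probability that two given terms agree, and `t`, the probability that all three agree. In these
coordinates the vertices are the points `(x, x²)` with `x = 1 / m` or `x = 0`. They lie on a
parabola, so strict convexity makes each of them extreme.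

The hull lies between the diagonal `t = s` and the chords joining consecutive vertices, which gives
the inequalities `m (m + 1) t - (2 m + 1) s + 1 ≥ 0`; `tripleLaw_mem_convexHull` shows that these
suffice. De Finetti's theorem is not needed to prove them for exchangeable sequences. For a finite
probability vector `p`, the pair `(∑ p², ∑ p³)` satisfies them by a compactness argument
(`chordForm_nonneg`). Applying this to the empirical measure of the first `N` terms, integrating and
letting `N → ∞` gives `IsExchangeable.chord_nonneg`.

Conversely, i.i.d. sequences realise every vertex, and mixing laws on sequence space makes the set
of attainable laws convex. -/

/-! ### The chord inequality on the simplex -/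

/-- The cubic expression whose nonnegativity places `(∑ p², ∑ p³)` above the chord of the parabola
through the parameters `1 / m` and `1 / (m + 1)`. -/
noncomputable def chordForm {ι : Type*} [Fintype ι] (m : ℕ) (p : ι → ℝ) : ℝ :=
  (m : ℝ) * (m + 1) * ∑ i, p i ^ 3 - (2 * m + 1) * ∑ i, p i ^ 2 + 1

theorem sum_update_pair {ι : Type*} [Fintype ι] [DecidableEq ι] (p : ι → ℝ) (g : ℝ → ℝ)
    {i j : ι} (hij : i ≠ j) (a b : ℝ) :
    ∑ k, g (Function.update (Function.update p i a) j b k) =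
      ∑ k, g (p k) - g (p i) - g (p j) + g a + g b := by
  have key : ∀ q : ι → ℝ, ∑ k, g (q k) =
      g (q i) + g (q j) + ∑ k ∈ (Finset.univ.erase i).erase j, g (q k) := by
    intro q
    rw [← Finset.add_sum_erase _ _ (Finset.mem_univ i),
      ← Finset.add_sum_erase (Finset.univ.erase i) _
        (Finset.mem_erase.2 ⟨hij.symm, Finset.mem_univ j⟩), add_assoc]
  rw [key, key p]
  have : ∑ k ∈ (Finset.univ.erase i).erase j,
      g (Function.update (Function.update p i a) j b k) =
      ∑ k ∈ (Finset.univ.erase i).erase j, g (p k) := by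
    refine Finset.sum_congr rfl fun k hk => ?_
    simp only [Finset.mem_erase] at hk
    rw [Function.update_of_ne hk.1, Function.update_of_ne hk.2.1]
  rw [this]
  simp [Function.update_of_ne hij]
  ring

/-- With `u = a + b` fixed, `a² + b² = u² - 2ab` and `a³ + b³ = u³ - 3uab`, so the form is affine in
the product `ab`, with a slope depending only on `u`. -/
theorem chordForm_update_pair {ι : Type*} [Fintype ι] [DecidableEq ι] (m : ℕ) (p : ι → ℝ)
    {i j : ι} (hij : i ≠ j) {a b : ℝ} (hab : a + b = p i + p j) :
    chordForm m (Function.update (Function.update p i a) j b) =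
      chordForm m p + (a * b - p i * p j) *
        (2 * (2 * m + 1) - 3 * (p i + p j) * (m * (m + 1))) := by
  unfold chordForm
  rw [sum_update_pair p (fun x => x ^ 3) hij, sum_update_pair p (fun x => x ^ 2) hij]
  obtain rfl : b = p i + p j - a := by linarith
  ring

theorem update_pair_mem_stdSimplex {ι : Type*} [Fintype ι] [DecidableEq ι] {p : ι → ℝ}
    (hp : p ∈ stdSimplex ℝ ι) {i j : ι} (hij : i ≠ j) {a b : ℝ} (ha : 0 ≤ a) (hb : 0 ≤ b)
    (hab : a + b = p i + p j) :
    Function.update (Function.update p i a) j b ∈ stdSimplex ℝ ι := by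
  refine ⟨fun k => ?_, ?_⟩
  · rcases eq_or_ne k j with rfl | hkj
    · simpa
    rw [Function.update_of_ne hkj]
    rcases eq_or_ne k i with rfl | hki
    · simpa
    rw [Function.update_of_ne hki]
    exact hp.1 k
  · have := sum_update_pair p id hij a b
    simp only [id] at this
    rw [this, hp.2]
    linarith

/-- With `r` atoms of mass `1 / r` the form equals `(m - r)(m + 1 - r) / r²`, and a product of
consecutive integers is never negative. -/
theorem chordForm_nonneg_of_eq_on_support {ι : Type*} [Fintype ι] (m : ℕ) {p : ι → ℝ}
    (hp : p ∈ stdSimplex ℝ ι) (h : ∀ i j, p i ≠ 0 → p j ≠ 0 → p i = p j) :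
    0 ≤ chordForm m p := by
  classical
  have hne : ∃ i, p i ≠ 0 := by
    by_contra! h0
    have := hp.2
    simp [h0] at this
  obtain ⟨i, hi⟩ := hne
  set s : Finset ι := Finset.univ.filter fun k => p k ≠ 0 with hs
  have hval : ∀ k, p k = if k ∈ s then p i else 0 := by
    intro k
    by_cases hk : p k = 0
    · simp [hs, hk]
    · simp [hs, h k i hk hi]
  have hsum : ∀ n : ℕ, n ≠ 0 → ∑ k, p k ^ n = s.card * p i ^ n := by
    intro n hn
    have : ∀ k, p k ^ n = if k ∈ s then p i ^ n else 0 := by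
      intro k
      rw [hval k]
      split_ifs <;> simp [hn]
    rw [Finset.sum_congr rfl fun k _ => this k]
    simp
  have h1 := hsum 1 one_ne_zero
  simp only [pow_one] at h1
  rw [hp.2] at h1
  unfold chordForm
  rw [hsum 3 (by norm_num), hsum 2 (by norm_num)]
  have hint : (0 : ℝ) ≤ ((m : ℝ) - s.card) * (m + 1 - s.card) := by
    have : (0 : ℤ) ≤ ((m : ℤ) - s.card) * (m + 1 - s.card) := by
      rcases le_or_gt (s.card : ℤ) m with h | h
      · exact mul_nonneg (by linarith) (by linarith)
      · exact mul_nonneg_of_nonpos_of_nonpos (by linarith) (by omega)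
    exact_mod_cast this
  have : (m : ℝ) * (m + 1) * (s.card * p i ^ 3) - (2 * m + 1) * (s.card * p i ^ 2) + 1
      = ((m : ℝ) - s.card) * (m + 1 - s.card) * p i ^ 2 := by
    linear_combination (-(m : ℝ) * (m + 1) * p i ^ 2 + 1 + s.card * p i) * h1
  rw [this]
  exact mul_nonneg hint (sq_nonneg _)

/-- A minimizer of `chordForm` with the smallest support is uniform on its support. -/
theorem chordForm_nonneg {ι : Type*} [Fintype ι] (m : ℕ) {p : ι → ℝ}
    (hp : p ∈ stdSimplex ℝ ι) : 0 ≤ chordForm m p := by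
  classical
  have hcont : Continuous (chordForm m : (ι → ℝ) → ℝ) := by
    unfold chordForm
    fun_prop
  let M : Set (ι → ℝ) := {q | q ∈ stdSimplex ℝ ι ∧
    ∀ r ∈ stdSimplex ℝ ι, chordForm m q ≤ chordForm m r}
  let c : (ι → ℝ) → ℕ := fun q => (Finset.univ.filter fun k => q k ≠ 0).card
  have hM : M.Nonempty := by
    obtain ⟨q, hq, hmin⟩ := (isCompact_stdSimplex ℝ ι).exists_isMinOn ⟨p, hp⟩ hcont.continuousOn
    exact ⟨q, hq, fun r hr => hmin hr⟩
  let q := Function.argminOn c M hM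
  have hq : q ∈ M := Function.argminOn_mem c M hM
  refine le_trans (chordForm_nonneg_of_eq_on_support m hq.1 ?_) (hq.2 p hp)
  intro i j hi hj
  by_contra hne
  have hij : i ≠ j := fun h => hne (by rw [h])
  have hi0 : 0 < q i := lt_of_le_of_ne (hq.1.1 i) (Ne.symm hi)
  have hj0 : 0 < q j := lt_of_le_of_ne (hq.1.1 j) (Ne.symm hj)
  -- Two competitors keep the sum of two unequal masses: merging them brings the product down to
  -- `0`, averaging raises it. Minimality against both forces the slope `C` to vanish, so merging
  -- yields a minimizer with smaller support.
  have hab : (q i + q j) + 0 = q i + q j := add_zero _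
  have hab' : (q i + q j) / 2 + (q i + q j) / 2 = q i + q j := by ring
  have hmem := update_pair_mem_stdSimplex hq.1 hij (by positivity) le_rfl hab
  have hmem' := update_pair_mem_stdSimplex hq.1 hij (by positivity) (by positivity) hab'
  have hf := chordForm_update_pair m q hij hab
  have h1 := hq.2 _ hmem
  have h2 := hq.2 _ hmem'
  rw [chordForm_update_pair m q hij hab'] at h2
  rw [hf] at h1
  set C := 2 * (2 * (m : ℝ) + 1) - 3 * (q i + q j) * (m * (m + 1)) with hC
  have hC0 : C = 0 := by
    have hle : C ≤ 0 := by
      have : 0 < q i * q j := by positivity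
      nlinarith
    have hge : 0 ≤ C := by
      have : 0 < (q i + q j) / 2 * ((q i + q j) / 2) - q i * q j := by
        have := sq_pos_of_ne_zero (sub_ne_zero.2 hne)
        nlinarith
      exact nonneg_of_mul_nonneg_right (by linarith) this
    exact le_antisymm hle hge
  rw [hC0, mul_zero, add_zero] at hf
  set r := Function.update (Function.update q i (q i + q j)) j 0 with hr
  have hrM : r ∈ M := ⟨hmem, fun u hu => hf ▸ hq.2 u hu⟩
  refine Function.not_lt_argminOn c M hrM (Finset.card_lt_card ?_)
  rw [Finset.ssubset_iff_of_subset]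
  · exact ⟨j, by simpa using hj, by simp [hr]⟩
  · intro k hk
    simp only [Finset.mem_filter, Finset.mem_univ, true_and] at hk ⊢
    rcases eq_or_ne k j with rfl | hkj
    · exact hj
    rcases eq_or_ne k i with rfl | hki
    · exact hi
    · rwa [hr, Function.update_of_ne hkj, Function.update_of_ne hki] at hk

/-- The chord inequality for the empirical measure of a finite sequence. -/
theorem chord_count_nonneg {α : Type*} [DecidableEq α] (m N : ℕ) (hN : 0 < N) (x : Fin N → α) :
    0 ≤ (m : ℝ) * (m + 1) * (∑ i, ∑ j, ∑ k, if x i = x j ∧ x i = x k then (1 : ℝ) else 0) / N ^ 3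
      - (2 * m + 1) * (∑ i, ∑ j, if x i = x j then (1 : ℝ) else 0) / N ^ 2 + 1 := by
  have hN' : (N : ℝ) ≠ 0 := by positivity
  let S := Finset.univ.image x
  let n : α → ℝ := fun a => (Finset.univ.filter fun i => x i = a).card
  have hcomp : ∀ f : α → ℝ, ∑ i, f (x i) = ∑ a : S, n a * f a := by
    intro f
    rw [Finset.sum_comp f x, ← Finset.sum_coe_sort]
    simp [n, S]
  have hn : ∀ i, ∑ j, (if x i = x j then (1 : ℝ) else 0) = n (x i) := by
    intro i
    simp [n, eq_comm]
  have h2 : ∑ i, ∑ j, (if x i = x j then (1 : ℝ) else 0) = ∑ a : S, n a ^ 2 := by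
    rw [Finset.sum_congr rfl fun i _ => hn i, hcomp]
    simp [sq]
  have h3 : ∑ i, ∑ j, ∑ k, (if x i = x j ∧ x i = x k then (1 : ℝ) else 0) =
      ∑ a : S, n a ^ 3 := by
    have : ∀ i, ∑ j, ∑ k, (if x i = x j ∧ x i = x k then (1 : ℝ) else 0) = n (x i) ^ 2 := by
      intro i
      rw [sq, ← hn i, Finset.sum_mul_sum]
      refine Finset.sum_congr rfl fun j _ => Finset.sum_congr rfl fun k _ => ?_
      by_cases h : x i = x j <;> by_cases h' : x i = x k <;> simp [h, h']
    rw [Finset.sum_congr rfl fun i _ => this i, hcomp fun a => n a ^ 2]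
    exact Finset.sum_congr rfl fun a _ => by ring
  have h1 : ∑ a : S, n a = N := by
    have := hcomp fun _ => 1
    simpa using this.symm
  have hp : (fun a : S => n a / N) ∈ stdSimplex ℝ S :=
    ⟨fun a => by positivity, by rw [← Finset.sum_div, h1, div_self hN']⟩
  have := chordForm_nonneg m hp
  unfold chordForm at this
  simp only [div_pow, ← Finset.sum_div] at this
  rw [h2, h3]
  simpa only [mul_div_assoc] using this

/-! ### Coincidence probabilities and the vertices in these coordinates -/

/-- The law on `{1, 2, 3}` of the number of distinct values among three exchangeable variables,
when two given ones agree with probability `s` and all three agree with probability `t`. -/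
def tripleLaw (s t : ℝ) : Fin 3 → ℝ := ![t, 3 * (s - t), 1 - 3 * s + 2 * t]

open Classical in
theorem numDistinct_fin_three {α : Type*} (x : Fin 3 → α) :
    numDistinct x = if x 0 = x 1 then if x 0 = x 2 then 1 else 2
      else if x 0 = x 2 ∨ x 1 = x 2 then 2 else 3 := by
  have hr : Set.range x = (({x 0, x 1, x 2} : Finset α) : Set α) := by
    ext a
    simp [Fin.exists_fin_succ, eq_comm]
  rw [numDistinct, hr, Set.ncard_coe_finset]
  split_ifs with h1 h2 h3
  · simp [← h1, ← h2]
  · rw [← h1]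
    simp [h2]
  · rcases h3 with h3 | h3
    · rw [← h3, Finset.card_eq_two]
      exact ⟨x 0, x 1, h1, by ext; simp; tauto⟩
    · rw [← h3]
      simp [h1]
  · push Not at h3
    exact Finset.card_eq_three.2 ⟨_, _, _, h1, h3.1, h3.2, rfl⟩

theorem numDistinct_fin_three_eq_one {α : Type*} {x : Fin 3 → α} :
    numDistinct x = 1 ↔ x 0 = x 1 ∧ x 0 = x 2 := by
  classical
  rw [numDistinct_fin_three]
  split_ifs <;> simp_all

theorem numDistinct_fin_three_eq_three {α : Type*} {x : Fin 3 → α} :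
    numDistinct x = 3 ↔ ¬ (x 0 = x 1 ∨ x 0 = x 2 ∨ x 1 = x 2) := by
  classical
  rw [numDistinct_fin_three]
  split_ifs <;> simp_all

theorem numDistinct_fin_three_eq_two {α : Type*} {x : Fin 3 → α} :
    numDistinct x = 2 ↔
      (x 0 = x 1 ∨ x 0 = x 2 ∨ x 1 = x 2) ∧ ¬ (x 0 = x 1 ∧ x 0 = x 2) := by
  classical
  rw [numDistinct_fin_three]
  split_ifs <;> simp_all

/-- Inclusion-exclusion: by transitivity of equality, any two of the three pairwise coincidences
force the triple one, so their union has probability `3s - 2t`. -/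
theorem lawNumDistinct_eq_tripleLaw {Ω α : Type*} [MeasurableSpace Ω] (P : Measure Ω)
    [IsProbabilityMeasure P] (X : Fin 3 → Ω → α) {s t : ℝ}
    (hX : ∀ i j, MeasurableSet {ω | X i ω = X j ω})
    (h01 : P.real {ω | X 0 ω = X 1 ω} = s) (h02 : P.real {ω | X 0 ω = X 2 ω} = s)
    (h12 : P.real {ω | X 1 ω = X 2 ω} = s)
    (h : P.real {ω | X 0 ω = X 1 ω ∧ X 0 ω = X 2 ω} = t) :
    lawNumDistinct P X = tripleLaw s t := by
  set A := {ω | X 0 ω = X 1 ω}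
  set B := {ω | X 0 ω = X 2 ω}
  set C := {ω | X 1 ω = X 2 ω}
  set T := {ω | X 0 ω = X 1 ω ∧ X 0 ω = X 2 ω}
  have hAB : A ∩ B = T := rfl
  have hABC : (A ∪ B) ∩ C = T := by
    ext ω
    simp only [A, B, C, T, Set.mem_inter_iff, Set.mem_union, Set.mem_ofPred_eq]
    constructor
    · rintro ⟨h | h, h'⟩
      · exact ⟨h, h.trans h'⟩
      · exact ⟨h.trans h'.symm, h⟩
    · rintro ⟨h, h'⟩
      exact ⟨Or.inl h, h.symm.trans h'⟩
  have hmT : MeasurableSet T := (hX 0 1).inter (hX 0 2)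
  have hmU : MeasurableSet (A ∪ B ∪ C) := ((hX 0 1).union (hX 0 2)).union (hX 1 2)
  have hU : P.real (A ∪ B ∪ C) = 3 * s - 2 * t := by
    have h1 := measureReal_union_add_inter (μ := P) (s := A ∪ B) (hX 1 2)
    have h2 := measureReal_union_add_inter (μ := P) (s := A) (hX 0 2)
    change P.real (A ∪ B ∪ C) + P.real ((A ∪ B) ∩ C) = P.real (A ∪ B) + P.real C at h1
    change P.real (A ∪ B) + P.real (A ∩ B) = P.real A + P.real B at h2
    rw [hABC] at h1
    rw [hAB] at h2
    linarith
  have hTU : T ⊆ A ∪ B ∪ C := fun ω hω => Or.inl (Or.inl hω.1)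
  ext k
  fin_cases k
  · have : {ω | numDistinct (fun i => X i ω) = 0 + 1} = T := by
      ext ω
      exact numDistinct_fin_three_eq_one
    simp [lawNumDistinct, tripleLaw, this, h]
  · have : {ω | numDistinct (fun i => X i ω) = 1 + 1} = (A ∪ B ∪ C) \ T := by
      ext ω
      refine numDistinct_fin_three_eq_two.trans ?_
      simp [A, B, C, T, or_assoc]
    have h3 := measureReal_sdiff (μ := P) hTU hmT
    simp only [lawNumDistinct, tripleLaw]
    simp
    rw [show (2 : ℕ) = 1 + 1 from rfl, this, h3, hU, h]
    ring
  · have : {ω | numDistinct (fun i => X i ω) = 3} = (A ∪ B ∪ C)ᶜ := by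
      ext ω
      refine numDistinct_fin_three_eq_three.trans ?_
      simp [A, B, C, and_assoc]
    simp only [lawNumDistinct, tripleLaw]
    simp
    rw [this, probReal_compl_eq_one_sub hmU, hU]
    ring

theorem limitLaw_three : limitLaw 3 = tripleLaw 0 0 := by
  ext k
  fin_cases k <;> simp [limitLaw, tripleLaw]

theorem uniformLaw_three {m : ℕ} (hm : 1 ≤ m) :
    uniformLaw 3 m = tripleLaw ((m : ℝ)⁻¹) ((m : ℝ)⁻¹ ^ 2) := by
  have : NeZero m := ⟨by omega⟩
  have hm' : (m : ℝ) ≠ 0 := by positivity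
  have hP : (Measure.pi fun _ : Fin 3 => uniformOn (Set.univ : Set (Fin m))) =
      uniformOn (Set.univ : Set (Fin 3 → Fin m)) := by
    rw [← uniformOn_pi, Set.pi_univ]
  have hcard : ∀ S : Set (Fin 3 → Fin m),
      (uniformOn (Set.univ : Set (Fin 3 → Fin m))).real S = S.ncard / (m : ℝ) ^ 3 := by
    intro S
    rw [measureReal_def, uniformOn_univ, Measure.count_apply_finite S S.toFinite,
      Set.ncard_eq_toFinset_card S S.toFinite]
    simp
  -- Each pairwise coincidence leaves two free coordinates, hence has probability `m² / m³`.
  have hrange : ∀ {S : Set (Fin 3 → Fin m)} (f : Fin m × Fin m → Fin 3 → Fin m),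
      Function.Injective f → S = Set.range f →
      (uniformOn (Set.univ : Set (Fin 3 → Fin m))).real S = (m : ℝ)⁻¹ := by
    intro S f hf hS
    rw [hcard, hS, ← Nat.card_coe_set_eq, Nat.card_range_of_injective hf]
    simp
    field_simp
  unfold uniformLaw
  rw [hP]
  refine lawNumDistinct_eq_tripleLaw _ _ (fun i j => (Set.toFinite _).measurableSet) ?_ ?_ ?_ ?_
  · refine hrange (fun p => ![p.1, p.1, p.2]) ?_ ?_
    · intro p q h
      exact Prod.ext (congrFun h 0) (congrFun h 2)
    · ext x
      constructor
      · intro h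
        refine ⟨(x 0, x 2), ?_⟩
        ext k; fin_cases k <;> simp_all
      · rintro ⟨p, rfl⟩; rfl
  · refine hrange (fun p => ![p.1, p.2, p.1]) ?_ ?_
    · intro p q h
      exact Prod.ext (congrFun h 0) (congrFun h 1)
    · ext x
      constructor
      · intro h
        refine ⟨(x 0, x 1), ?_⟩
        ext k; fin_cases k <;> simp_all
      · rintro ⟨p, rfl⟩; rfl
  · refine hrange (fun p => ![p.1, p.2, p.2]) ?_ ?_
    · intro p q h
      exact Prod.ext (congrFun h 0) (congrFun h 1)
    · ext x
      constructor
      · intro h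
        refine ⟨(x 0, x 1), ?_⟩
        ext k; fin_cases k <;> simp_all
      · rintro ⟨p, rfl⟩; rfl
  · have : {x : Fin 3 → Fin m | x 0 = x 1 ∧ x 0 = x 2} = Set.range (fun a _ => a) := by
      ext x
      constructor
      · rintro ⟨h, h'⟩
        refine ⟨x 0, ?_⟩
        ext k; fin_cases k <;> simp_all
      · rintro ⟨p, rfl⟩; exact ⟨rfl, rfl⟩
    rw [hcard, this, ← Nat.card_coe_set_eq,
      Nat.card_range_of_injective fun a b h => congrFun h (0 : Fin 3)]
    simp
    field_simp

/-! ### Convex geometry of the vertices -/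

theorem mem_lawVertices_three {v : Fin 3 → ℝ} (hv : v ∈ lawVertices 3) :
    ∃ x : ℝ, v = tripleLaw x (x ^ 2) := by
  rcases hv with ⟨m, hm, rfl⟩ | rfl
  · exact ⟨_, uniformLaw_three hm⟩
  · exact ⟨0, by rw [limitLaw_three]; norm_num⟩

theorem tripleLaw_inv_mem_lawVertices {m : ℕ} (hm : 1 ≤ m) :
    tripleLaw ((m : ℝ)⁻¹) ((m : ℝ)⁻¹ ^ 2) ∈ lawVertices 3 :=
  Or.inl ⟨m, hm, (uniformLaw_three hm).symm⟩

theorem tripleLaw_zero_mem_lawVertices : tripleLaw 0 0 ∈ lawVertices 3 :=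
  Or.inr limitLaw_three.symm

theorem tripleLaw_combo (a b s t s' t' : ℝ) (hab : a + b = 1) :
    a • tripleLaw s t + b • tripleLaw s' t' = tripleLaw (a * s + b * s') (a * t + b * t') := by
  ext k
  fin_cases k
  · simp [tripleLaw]
  · simp [tripleLaw]; ring
  · simp [tripleLaw]; linear_combination hab

/-- Points of the strictly convex curve `x ↦ (x, x ^ 2)` are exposed by its tangents. -/
theorem extremePoints_convexHull_lawVertices :
    (convexHull ℝ (lawVertices 3)).extremePoints ℝ = lawVertices 3 := by
  refine Set.Subset.antisymm extremePoints_convexHull_subset fun v hv => ?_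
  obtain ⟨x, rfl⟩ := mem_lawVertices_three hv
  set v := tripleLaw x (x ^ 2) with hvdef
  -- On `tripleLaw s t` this is `t - 2xs + x²`, the height above the tangent at `x`, since `s` is
  -- recovered as `w 0 + w 1 / 3`.
  let g : (Fin 3 → ℝ) → ℝ := fun w => w 0 - 2 * x * (w 0 + w 1 / 3) + x ^ 2
  have hg : ∀ y, g (tripleLaw y (y ^ 2)) = (y - x) ^ 2 := by
    intro y
    simp [g, tripleLaw]
    ring
  have hcombo : ∀ (w w' : Fin 3 → ℝ) (a b : ℝ), a + b = 1 →
      g (a • w + b • w') = a * g w + b * g w' := by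
    intro w w' a b hab
    simp [g]
    linear_combination -x ^ 2 * hab
  have hgv : g v = 0 := by rw [hg]; ring
  -- Adjoining the single point `v` to the open half-space keeps it convex, so the whole hull meets
  -- the tangent line only at `v`.
  have hconv : Convex ℝ {w | w = v ∨ 0 < g w} := by
    intro w hw w' hw' a b ha hb hab
    have hnn : ∀ u, u = v ∨ 0 < g u → 0 ≤ g u := by
      rintro u (rfl | h)
      · exact hgv.ge
      · exact h.le
    rcases ha.eq_or_lt with rfl | ha
    · obtain rfl : b = 1 := by linarith
      simpa using hw'
    rcases hb.eq_or_lt with rfl | hb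
    · obtain rfl : a = 1 := by linarith
      simpa using hw
    by_cases h : w = v ∧ w' = v
    · left
      rw [h.1, h.2, ← add_smul, hab, one_smul]
    · right
      rw [hcombo _ _ _ _ hab]
      rcases hw with rfl | hw0
      · rcases hw' with rfl | hw0'
        · exact absurd ⟨rfl, rfl⟩ h
        · rw [hgv]
          nlinarith [mul_pos hb hw0']
      · have := mul_nonneg hb.le (hnn _ hw')
        have := mul_pos ha hw0
        linarith
  have hsub : convexHull ℝ (lawVertices 3) ⊆ {w | w = v ∨ 0 < g w} := by
    refine convexHull_min ?_ hconv
    intro w hw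
    obtain ⟨y, rfl⟩ := mem_lawVertices_three hw
    rcases eq_or_ne y x with rfl | hyx
    · exact Or.inl rfl
    · right
      rw [hg]
      exact sq_pos_of_ne_zero (sub_ne_zero.2 hyx)
  rw [mem_extremePoints]
  refine ⟨subset_convexHull ℝ _ hv, fun w hw w' hw' hseg => ?_⟩
  obtain ⟨a, b, ha, hb, hab, he⟩ := hseg
  have h0 : a * g w + b * g w' = 0 := by rw [← hcombo _ _ _ _ hab, he, hgv]
  rcases hsub hw with hw | hw
  · refine ⟨hw, (hsub hw').resolve_right fun h => ?_⟩
    rw [hw, hgv] at h0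
    have := mul_pos hb h
    linarith
  · exfalso
    have h1 := mul_pos ha hw
    rcases hsub hw' with hw' | hw'
    · rw [hw', hgv] at h0
      linarith
    · have := mul_pos hb hw'
      linarith

/-- On the vertical line at `s`, the point lies between the diagonal, which joins the vertices for
`x = 0` and `x = 1`, and the chord over the interval containing `s`. -/
theorem tripleLaw_mem_convexHull {s t : ℝ} (ht : 0 ≤ t) (hts : t ≤ s) (hs : s ≤ 1)
    (h : ∀ m : ℕ, 1 ≤ m → 0 ≤ (m : ℝ) * (m + 1) * t - (2 * m + 1) * s + 1) :
    tripleLaw s t ∈ convexHull ℝ (lawVertices 3) := by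
  have hc := convex_convexHull ℝ (lawVertices 3)
  have hV := subset_convexHull ℝ (lawVertices 3)
  have h0 := hV tripleLaw_zero_mem_lawVertices
  have h1 := hV (tripleLaw_inv_mem_lawVertices le_rfl)
  rcases (ht.trans hts).eq_or_lt with rfl | hs0
  · obtain rfl : t = 0 := le_antisymm hts ht
    exact h0
  have hdiag : tripleLaw s s ∈ convexHull ℝ (lawVertices 3) := by
    have := hc h1 h0 hs0.le (sub_nonneg.2 hs) (by ring)
    rwa [tripleLaw_combo _ _ _ _ _ _ (by ring), show s * ((1 : ℕ) : ℝ)⁻¹ + (1 - s) * 0 = s by simp,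
      show s * ((1 : ℕ) : ℝ)⁻¹ ^ 2 + (1 - s) * 0 = s by simp] at this
  -- This choice gives `1 / (m + 1) ≤ s ≤ 1 / m`; `c` below is the height at `s` of the chord over
  -- that interval.
  set m := ⌊s⁻¹⌋₊ with hm
  have hm1 : 1 ≤ m := Nat.le_floor (by simpa using (one_le_inv₀ hs0).2 hs)
  have hms : (m : ℝ) * s ≤ 1 := by
    have := Nat.floor_le (inv_nonneg.2 hs0.le)
    rw [← hm] at this
    calc (m : ℝ) * s ≤ s⁻¹ * s := by gcongr
      _ = 1 := inv_mul_cancel₀ hs0.ne'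
  have hms' : 1 ≤ ((m : ℝ) + 1) * s := by
    have := (Nat.lt_floor_add_one s⁻¹).le
    rw [← hm] at this
    calc 1 = s⁻¹ * s := (inv_mul_cancel₀ hs0.ne').symm
      _ ≤ _ := by gcongr
  have hm0 : (0 : ℝ) < m := by exact_mod_cast hm1
  set c := ((2 * m + 1) * s - 1) / ((m : ℝ) * (m + 1)) with hcdef
  have hchord : tripleLaw s c ∈ convexHull ℝ (lawVertices 3) := by
    -- The barycentric weights of `s` with respect to `1 / m` and `1 / (m + 1)`.
    have ha : 0 ≤ (m : ℝ) * (((m : ℝ) + 1) * s - 1) := mul_nonneg hm0.le (by linarith)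
    have hb : 0 ≤ ((m : ℝ) + 1) * (1 - m * s) := mul_nonneg (by positivity) (by linarith)
    have hab : (m : ℝ) * (((m : ℝ) + 1) * s - 1) + ((m : ℝ) + 1) * (1 - m * s) = 1 := by ring
    have := hc (hV (tripleLaw_inv_mem_lawVertices hm1))
      (hV (tripleLaw_inv_mem_lawVertices (m := m + 1) (by omega))) ha hb hab
    rw [tripleLaw_combo _ _ _ _ _ _ hab] at this
    convert this using 2
    · push_cast
      field_simp
      ring
    · rw [hcdef]
      push_cast
      field_simp
      ring
  have hct : c ≤ t := by
    rw [hcdef, div_le_iff₀ (by positivity)]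
    have := h m hm1
    linarith
  have hseg : t ∈ segment ℝ c s := by
    rw [segment_eq_Icc (hct.trans hts)]
    exact ⟨hct, hts⟩
  obtain ⟨a, b, ha, hb, hab, he⟩ := hseg
  have := hc hchord hdiag ha hb hab
  rw [tripleLaw_combo _ _ _ _ _ _ hab, ← add_mul, hab, one_mul] at this
  simp only [smul_eq_mul] at he
  rwa [he] at this

/-! ### The chord inequality for exchangeable sequences -/

theorem exists_finite_support_perm {i j k : ℕ} (hij : i ≠ j) (hik : i ≠ k) (hjk : j ≠ k) :
    ∃ σ : Equiv.Perm ℕ, {n | σ n ≠ n}.Finite ∧ σ 0 = i ∧ σ 1 = j ∧ σ 2 = k := by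
  have hswap : ∀ a b : ℕ, {n | Equiv.swap a b n ≠ n}.Finite := fun a b =>
    (Set.toFinite {a, b}).subset fun n hn => by
      by_contra h
      simp only [Set.mem_insert_iff, Set.mem_singleton_iff, not_or] at h
      exact hn (Equiv.swap_apply_of_ne_of_ne h.1 h.2)
  have hmul : ∀ σ τ : Equiv.Perm ℕ, {n | σ n ≠ n}.Finite → {n | τ n ≠ n}.Finite →
      {n | (σ * τ) n ≠ n}.Finite := fun σ τ hσ hτ => (hσ.union hτ).subset fun n hn => by
    by_contra h
    simp only [Set.mem_union, Set.mem_ofPred_eq, not_or, not_not] at h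
    exact hn (by rw [Equiv.Perm.mul_apply, h.2, h.1])
  let σ₁ := Equiv.swap 0 i
  let j' := σ₁.symm j
  let σ₂ := σ₁ * Equiv.swap 1 j'
  let k' := σ₂.symm k
  have h₁0 : σ₁ 0 = i := Equiv.swap_apply_left 0 i
  have hj' : j' ≠ 0 := fun h => hij (by rw [← h₁0, ← h, Equiv.apply_symm_apply])
  have h₂0 : σ₂ 0 = i := by
    rw [Equiv.Perm.mul_apply, Equiv.swap_apply_of_ne_of_ne (by norm_num) hj'.symm, h₁0]
  have h₂1 : σ₂ 1 = j := by
    rw [Equiv.Perm.mul_apply, Equiv.swap_apply_left, Equiv.apply_symm_apply]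
  have hk0 : k' ≠ 0 := fun h => hik (by rw [← h₂0, ← h, Equiv.apply_symm_apply])
  have hk1 : k' ≠ 1 := fun h => hjk (by rw [← h₂1, ← h, Equiv.apply_symm_apply])
  -- Each swap is applied before the permutation already built and avoids the indices already
  -- placed, so their images stay correct.
  refine ⟨σ₂ * Equiv.swap 2 k', hmul _ _ (hmul _ _ (hswap _ _) (hswap _ _)) (hswap _ _), ?_, ?_, ?_⟩
  · rw [Equiv.Perm.mul_apply, Equiv.swap_apply_of_ne_of_ne (by norm_num) hk0.symm, h₂0]
  · rw [Equiv.Perm.mul_apply, Equiv.swap_apply_of_ne_of_ne (by norm_num) hk1.symm, h₂1]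
  · rw [Equiv.Perm.mul_apply, Equiv.swap_apply_left, Equiv.apply_symm_apply]

section Exchangeable

variable {Ω : Type*} [MeasurableSpace Ω] {P : Measure Ω} {X : ℕ → Ω → ℝ}

theorem IsExchangeable.measureReal_eq (h : IsExchangeable P X) (hX : ∀ i, Measurable (X i))
    {S : Set (ℝ × ℝ × ℝ)} (hS : MeasurableSet S) {i j k : ℕ} (hij : i ≠ j) (hik : i ≠ k)
    (hjk : j ≠ k) :
    P.real {ω | (X i ω, X j ω, X k ω) ∈ S} = P.real {ω | (X 0 ω, X 1 ω, X 2 ω) ∈ S} := by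
  obtain ⟨σ, hσ, h0, h1, h2⟩ := exists_finite_support_perm hij hik hjk
  have hmS : MeasurableSet {x : ℕ → ℝ | (x 0, x 1, x 2) ∈ S} :=
    (by fun_prop : Measurable fun x : ℕ → ℝ => (x 0, x 1, x 2)) hS
  have := congrArg (fun μ : Measure (ℕ → ℝ) => μ.real {x | (x 0, x 1, x 2) ∈ S}) (h σ hσ)
  rw [map_measureReal_apply (measurable_pi_lambda _ fun i => hX _) hmS,
    map_measureReal_apply (measurable_pi_lambda _ hX) hmS] at this
  simpa [h0, h1, h2] using this

theorem IsExchangeable.measureReal_pair_eq (h : IsExchangeable P X) (hX : ∀ i, Measurable (X i))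
    {i j : ℕ} (hij : i ≠ j) :
    P.real {ω | X i ω = X j ω} = P.real {ω | X 0 ω = X 1 ω} :=
  h.measureReal_eq hX (S := {p | p.1 = p.2.1}) (measurableSet_eq_fun (by fun_prop) (by fun_prop))
    -- A dummy third index, distinct from both others.
    (k := i + j + 1) hij (by omega) (by omega)

theorem IsExchangeable.measureReal_triple_eq (h : IsExchangeable P X)
    (hX : ∀ i, Measurable (X i)) {i j k : ℕ} (hij : i ≠ j) (hik : i ≠ k) (hjk : j ≠ k) :
    P.real {ω | X i ω = X j ω ∧ X i ω = X k ω} =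
      P.real {ω | X 0 ω = X 1 ω ∧ X 0 ω = X 2 ω} :=
  h.measureReal_eq hX (S := {p | p.1 = p.2.1 ∧ p.1 = p.2.2})
    ((measurableSet_eq_fun (by fun_prop) (by fun_prop)).inter
      (measurableSet_eq_fun (by fun_prop) (by fun_prop))) hij hik hjk

theorem IsExchangeable.lawNumDistinct_eq [IsProbabilityMeasure P] (h : IsExchangeable P X)
    (hX : ∀ i, Measurable (X i)) :
    lawNumDistinct P (fun i : Fin 3 => X i) =
      tripleLaw (P.real {ω | X 0 ω = X 1 ω}) (P.real {ω | X 0 ω = X 1 ω ∧ X 0 ω = X 2 ω}) :=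
  lawNumDistinct_eq_tripleLaw P _ (fun i j => measurableSet_eq_fun (hX i) (hX j)) rfl
    (h.measureReal_pair_eq hX (by norm_num)) (h.measureReal_pair_eq hX (by norm_num)) rfl

/-- Integrating the empirical chord inequality turns the sums over index tuples into `s` and `t`,
except for tuples with repeated indices; these account for the error `3 / N`. -/
theorem IsExchangeable.chord_nonneg_approx [IsProbabilityMeasure P] (h : IsExchangeable P X)
    (hX : ∀ i, Measurable (X i)) (m N : ℕ) (hN : 0 < N) :
    0 ≤ (m : ℝ) * (m + 1) * (P.real {ω | X 0 ω = X 1 ω ∧ X 0 ω = X 2 ω} + 3 / N)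
      - (2 * m + 1) * P.real {ω | X 0 ω = X 1 ω} + 1 := by
  classical
  set s := P.real {ω | X 0 ω = X 1 ω}
  set t := P.real {ω | X 0 ω = X 1 ω ∧ X 0 ω = X 2 ω}
  have hm2 : ∀ i j, MeasurableSet {ω | X i ω = X j ω} :=
    fun i j => measurableSet_eq_fun (hX i) (hX j)
  have hm3 : ∀ i j k, MeasurableSet {ω | X i ω = X j ω ∧ X i ω = X k ω} :=
    fun i j k => (hm2 i j).inter (hm2 i k)
  let f₂ : ℕ → ℕ → Ω → ℝ := fun i j ω => if X i ω = X j ω then 1 else 0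
  let f₃ : ℕ → ℕ → ℕ → Ω → ℝ := fun i j k ω => if X i ω = X j ω ∧ X i ω = X k ω then 1 else 0
  have hf₂ : ∀ i j, f₂ i j = {ω | X i ω = X j ω}.indicator 1 := by
    intro i j; ext ω; simp [f₂, Set.indicator_apply]
  have hf₃ : ∀ i j k, f₃ i j k = {ω | X i ω = X j ω ∧ X i ω = X k ω}.indicator 1 := by
    intro i j k; ext ω; simp [f₃, Set.indicator_apply]
  have hi₂ : ∀ i j, Integrable (f₂ i j) P := fun i j => by
    rw [hf₂]; exact (integrable_const 1).indicator (hm2 i j)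
  have hi₃ : ∀ i j k, Integrable (f₃ i j k) P := fun i j k => by
    rw [hf₃]; exact (integrable_const 1).indicator (hm3 i j k)
  have he₂ : ∀ i j, ∫ ω, f₂ i j ω ∂P = P.real {ω | X i ω = X j ω} := fun i j => by
    rw [hf₂, integral_indicator_one (hm2 i j)]
  have he₃ : ∀ i j k, ∫ ω, f₃ i j k ω ∂P = P.real {ω | X i ω = X j ω ∧ X i ω = X k ω} :=
    fun i j k => by rw [hf₃, integral_indicator_one (hm3 i j k)]
  have hI₂ : Integrable (fun ω => ∑ i : Fin N, ∑ j : Fin N, f₂ i j ω) P :=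
    integrable_finsetSum _ fun i _ => integrable_finsetSum _ fun j _ => hi₂ i j
  have hI₃ : Integrable (fun ω => ∑ i : Fin N, ∑ j : Fin N, ∑ k : Fin N, f₃ i j k ω) P :=
    integrable_finsetSum _ fun i _ => integrable_finsetSum _ fun j _ =>
      integrable_finsetSum _ fun k _ => hi₃ i j k
  have hE₂ : ∫ ω, ∑ i : Fin N, ∑ j : Fin N, f₂ i j ω ∂P =
      ∑ i : Fin N, ∑ j : Fin N, P.real {ω | X i ω = X j ω} := by
    rw [integral_finsetSum _ fun i _ => integrable_finsetSum _ fun j _ => hi₂ _ _]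
    refine Finset.sum_congr rfl fun i _ => ?_
    rw [integral_finsetSum _ fun j _ => hi₂ _ _]
    exact Finset.sum_congr rfl fun j _ => he₂ _ _
  have hE₃ : ∫ ω, ∑ i : Fin N, ∑ j : Fin N, ∑ k : Fin N, f₃ i j k ω ∂P =
      ∑ i : Fin N, ∑ j : Fin N, ∑ k : Fin N, P.real {ω | X i ω = X j ω ∧ X i ω = X k ω} := by
    rw [integral_finsetSum _ fun i _ => integrable_finsetSum _ fun j _ =>
      integrable_finsetSum _ fun k _ => hi₃ _ _ _]
    refine Finset.sum_congr rfl fun i _ => ?_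
    rw [integral_finsetSum _ fun j _ => integrable_finsetSum _ fun k _ => hi₃ _ _ _]
    refine Finset.sum_congr rfl fun j _ => ?_
    rw [integral_finsetSum _ fun k _ => hi₃ _ _ _]
    exact Finset.sum_congr rfl fun k _ => he₃ _ _ _
  -- Diagonal pairs contribute `1 ≥ s`. A lower bound is enough, because this sum enters with a
  -- negative coefficient.
  have hlow : (N : ℝ) ^ 2 * s ≤ ∑ i : Fin N, ∑ j : Fin N, P.real {ω | X i ω = X j ω} := by
    have : ∀ i j : Fin N, s ≤ P.real {ω | X i ω = X j ω} := by
      intro i j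
      rcases eq_or_ne i j with rfl | hij
      · simpa using measureReal_le_one
      · exact (h.measureReal_pair_eq hX (Fin.val_ne_of_ne hij)).ge
    calc (N : ℝ) ^ 2 * s = ∑ i : Fin N, ∑ j : Fin N, s := by simp; ring
      _ ≤ _ := Finset.sum_le_sum fun i _ => Finset.sum_le_sum fun j _ => this i j
  -- Each of the three possible index equalities holds for `N²` triples, and each probability is at
  -- most `1`.
  have hup : ∑ i : Fin N, ∑ j : Fin N, ∑ k : Fin N, P.real {ω | X i ω = X j ω ∧ X i ω = X k ω} ≤
      (N : ℝ) ^ 3 * t + 3 * N ^ 2 := by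
    have ht0 : 0 ≤ t := measureReal_nonneg
    have : ∀ i j k : Fin N, P.real {ω | X i ω = X j ω ∧ X i ω = X k ω} ≤
        t + ((if i = j then 1 else 0) + (if i = k then 1 else 0) + (if j = k then 1 else 0)) := by
      intro i j k
      have h1 : P.real {ω | X i ω = X j ω ∧ X i ω = X k ω} ≤ 1 := measureReal_le_one
      by_cases hij : i = j
      · rw [if_pos hij]
        split_ifs <;> linarith
      by_cases hik : i = k
      · rw [if_pos hik]
        split_ifs <;> linarith
      by_cases hjk : j = k
      · rw [if_pos hjk]
        split_ifs <;> linarith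
      rw [h.measureReal_triple_eq hX (Fin.val_ne_of_ne hij) (Fin.val_ne_of_ne hik)
        (Fin.val_ne_of_ne hjk)]
      simp [hij, hik, hjk, t]
    refine (Finset.sum_le_sum fun i _ => Finset.sum_le_sum fun j _ =>
      Finset.sum_le_sum fun k _ => this i j k).trans_eq ?_
    simp [Finset.sum_add_distrib]
    ring
  have hpt : ∀ ω, 0 ≤ (m : ℝ) * (m + 1) * (∑ i : Fin N, ∑ j : Fin N, ∑ k : Fin N, f₃ i j k ω)
      / N ^ 3 - (2 * m + 1) * (∑ i : Fin N, ∑ j : Fin N, f₂ i j ω) / N ^ 2 + 1 :=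
    fun ω => chord_count_nonneg m N hN fun i => X i ω
  have hint := integral_nonneg_of_ae (μ := P) (Filter.Eventually.of_forall hpt)
  have hdiff : Integrable (fun ω =>
      (m : ℝ) * (m + 1) * (∑ i : Fin N, ∑ j : Fin N, ∑ k : Fin N, f₃ i j k ω) / N ^ 3
      - (2 * m + 1) * (∑ i : Fin N, ∑ j : Fin N, f₂ i j ω) / N ^ 2) P :=
    ((hI₃.const_mul _).div_const _).sub ((hI₂.const_mul _).div_const _)
  rw [integral_add hdiff (integrable_const _), integral_sub ((hI₃.const_mul _).div_const _)
    ((hI₂.const_mul _).div_const _), integral_div, integral_div, integral_const_mul,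
    integral_const_mul, hE₂, hE₃] at hint
  simp only [integral_const, probReal_univ, smul_eq_mul, mul_one] at hint
  have hN' : (0 : ℝ) < N := by exact_mod_cast hN
  refine hint.trans ?_
  gcongr
  · calc _ ≤ (m : ℝ) * (m + 1) * ((N : ℝ) ^ 3 * t + 3 * N ^ 2) / N ^ 3 := by gcongr
      _ = _ := by field_simp
  · calc (2 * (m : ℝ) + 1) * s = (2 * m + 1) * ((N : ℝ) ^ 2 * s) / N ^ 2 := by field_simp
      _ ≤ _ := by gcongr

theorem IsExchangeable.chord_nonneg [IsProbabilityMeasure P] (h : IsExchangeable P X)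
    (hX : ∀ i, Measurable (X i)) (m : ℕ) :
    0 ≤ (m : ℝ) * (m + 1) * P.real {ω | X 0 ω = X 1 ω ∧ X 0 ω = X 2 ω}
      - (2 * m + 1) * P.real {ω | X 0 ω = X 1 ω} + 1 := by
  have hlim : Filter.Tendsto (fun N : ℕ => (m : ℝ) * (m + 1) *
      (P.real {ω | X 0 ω = X 1 ω ∧ X 0 ω = X 2 ω} + 3 / N)
      - (2 * m + 1) * P.real {ω | X 0 ω = X 1 ω} + 1) Filter.atTop
      (nhds ((m : ℝ) * (m + 1) * (P.real {ω | X 0 ω = X 1 ω ∧ X 0 ω = X 2 ω} + 0)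
      - (2 * m + 1) * P.real {ω | X 0 ω = X 1 ω} + 1)) :=
    ((((tendsto_const_div_atTop_nhds_zero_nat 3).const_add _).const_mul _).sub_const _).add_const _
  rw [add_zero] at hlim
  refine ge_of_tendsto hlim ?_
  filter_upwards [Filter.eventually_gt_atTop 0] with N hN
  exact h.chord_nonneg_approx hX m N hN

end Exchangeable

theorem exchangeableLaws_subset :
    exchangeableLaws.{u} 3 ⊆ convexHull ℝ (lawVertices 3) := by
  rintro _ ⟨Ω, _, P, X, _, hX, h, rfl⟩
  rw [h.lawNumDistinct_eq hX]
  exact tripleLaw_mem_convexHull measureReal_nonneg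
    (measureReal_mono fun ω hω => hω.1) measureReal_le_one fun m _ => h.chord_nonneg hX m

/-! ### Realising every point of the hull -/

theorem isExchangeable_map_iff {Ω : Type*} [MeasurableSpace Ω] {P : Measure Ω} {X : ℕ → Ω → ℝ}
    (hX : ∀ i, Measurable (X i)) :
    IsExchangeable (P.map fun ω i => X i ω) (fun i x => x i) ↔ IsExchangeable P X := by
  unfold IsExchangeable
  refine forall₂_congr fun σ _ => ?_
  rw [Measure.map_map (by fun_prop) (by fun_prop), Measure.map_map (by fun_prop) (by fun_prop)]
  rfl

/-- Only the joint law of the sequence matters, so it can be carried to the coordinate process on a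
`ULift` of `ℕ → ℝ`. This frees later constructions from the universe `u`. -/
theorem lawNumDistinct_mem_exchangeableLaws {Ω : Type*} [MeasurableSpace Ω] {P : Measure Ω}
    [IsProbabilityMeasure P] {X : ℕ → Ω → ℝ} (hX : ∀ i, Measurable (X i))
    (h : IsExchangeable P X) :
    lawNumDistinct P (fun i : Fin 3 => X i) ∈ exchangeableLaws.{u} 3 := by
  let μ : Measure (ℕ → ℝ) := P.map fun ω i => X i ω
  have hXm : Measurable fun ω i => X i ω := measurable_pi_lambda _ hX
  have hμ : IsProbabilityMeasure μ := Measure.isProbabilityMeasure_map hXm.aemeasurable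
  let Q : Measure (ULift.{u} (ℕ → ℝ)) := μ.map ULift.up
  have hQ : IsProbabilityMeasure Q :=
    Measure.isProbabilityMeasure_map measurable_up.aemeasurable
  let Y : ℕ → ULift.{u} (ℕ → ℝ) → ℝ := fun i x => x.down i
  have hY : ∀ i, Measurable (Y i) := fun i => (measurable_pi_apply i).comp measurable_down
  have hYm : Measurable fun ω i => Y i ω := measurable_pi_lambda _ hY
  have hYQ : Q.map (fun ω i => Y i ω) = μ := by
    rw [Measure.map_map hYm measurable_up]
    exact Measure.map_id
  have hYe : IsExchangeable Q Y := by
    rw [← isExchangeable_map_iff hY, hYQ]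
    exact (isExchangeable_map_iff hX).2 h
  have hreal : ∀ S : Set (ℕ → ℝ), MeasurableSet S →
      P.real {ω | (fun i => X i ω) ∈ S} = Q.real {ω | (fun i => Y i ω) ∈ S} := by
    intro S hS
    calc P.real {ω | (fun i => X i ω) ∈ S} = μ.real S := (map_measureReal_apply hXm hS).symm
      _ = _ := by rw [← hYQ, map_measureReal_apply hYm hS]; rfl
  refine ⟨_, _, Q, Y, hQ, hY, hYe, ?_⟩
  have hS : MeasurableSet {x : ℕ → ℝ | x 0 = x 1} :=
    measurableSet_eq_fun (by fun_prop) (by fun_prop)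
  have hS' : MeasurableSet {x : ℕ → ℝ | x 0 = x 2} :=
    measurableSet_eq_fun (by fun_prop) (by fun_prop)
  rw [h.lawNumDistinct_eq hX, hYe.lawNumDistinct_eq hY]
  exact congrArg₂ tripleLaw (hreal _ hS) (hreal _ (hS.inter hS'))

/-- Exchangeability is a linear condition on the joint law, so a mixture of two exchangeable laws on
`ℕ → ℝ` is exchangeable, and coincidence probabilities mix with the same weights. -/
theorem convex_exchangeableLaws : Convex ℝ (exchangeableLaws.{u} 3) := by
  rintro _ ⟨Ω, _, P, X, _, hX, h, rfl⟩ _ ⟨Ω', _, P', X', _, hX', h', rfl⟩ a b ha hb hab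
  let A := ENNReal.ofReal a
  let B := ENNReal.ofReal b
  have hAB : A + B = 1 := by
    rw [← ENNReal.ofReal_add ha hb, hab, ENNReal.ofReal_one]
  let μ : Measure (ℕ → ℝ) := P.map fun ω i => X i ω
  let μ' : Measure (ℕ → ℝ) := P'.map fun ω i => X' i ω
  have hXm : Measurable fun ω i => X i ω := measurable_pi_lambda _ hX
  have hXm' : Measurable fun ω i => X' i ω := measurable_pi_lambda _ hX'
  have hμ : IsProbabilityMeasure μ := Measure.isProbabilityMeasure_map hXm.aemeasurable
  have hμ' : IsProbabilityMeasure μ' := Measure.isProbabilityMeasure_map hXm'.aemeasurable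
  let Q := A • μ + B • μ'
  have hQ : IsProbabilityMeasure Q := ⟨by simp [Q, hAB]⟩
  have hQe : IsExchangeable Q fun i x => x i := by
    intro σ hσ
    have e := (isExchangeable_map_iff hX).2 h σ hσ
    have e' := (isExchangeable_map_iff hX').2 h' σ hσ
    rw [Measure.map_add _ _ (by fun_prop), Measure.map_add _ _ (by fun_prop), Measure.map_smul,
      Measure.map_smul, Measure.map_smul, Measure.map_smul, e, e']
  have hreal : ∀ S : Set (ℕ → ℝ), MeasurableSet S → Q.real S =
      a * P.real {ω | (fun i => X i ω) ∈ S} + b * P'.real {ω | (fun i => X' i ω) ∈ S} := by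
    intro S hS
    have e : μ.real S = P.real {ω | (fun i => X i ω) ∈ S} := map_measureReal_apply hXm hS
    have e' : μ'.real S = P'.real {ω | (fun i => X' i ω) ∈ S} := map_measureReal_apply hXm' hS
    have hfin : ∀ (c : ℝ) (ρ : Measure (ℕ → ℝ)) [IsProbabilityMeasure ρ],
        (ENNReal.ofReal c • ρ) S ≠ ⊤ := fun c ρ _ =>
      ENNReal.mul_ne_top ENNReal.ofReal_ne_top (measure_ne_top ρ S)
    rw [← e, ← e', measureReal_add_apply (hfin a μ) (hfin b μ'), measureReal_ennreal_smul_apply,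
      measureReal_ennreal_smul_apply, ENNReal.toReal_ofReal ha, ENNReal.toReal_ofReal hb]
  have := lawNumDistinct_mem_exchangeableLaws.{u} (P := Q) (X := fun i x => x i)
    (fun i => measurable_pi_apply i) hQe
  have hS : MeasurableSet {x : ℕ → ℝ | x 0 = x 1} :=
    measurableSet_eq_fun (by fun_prop) (by fun_prop)
  have hS' : MeasurableSet {x : ℕ → ℝ | x 0 = x 1 ∧ x 0 = x 2} :=
    hS.inter (measurableSet_eq_fun (by fun_prop) (by fun_prop))
  rw [hQe.lawNumDistinct_eq fun i => measurable_pi_apply i, hreal _ hS,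
    hreal _ hS'] at this
  rw [h.lawNumDistinct_eq hX, h'.lawNumDistinct_eq hX', tripleLaw_combo _ _ _ _ _ _ hab]
  exact this

theorem isExchangeable_infinitePi {α : Type*} [MeasurableSpace α] (ν : Measure α)
    [IsProbabilityMeasure ν] {f : α → ℝ} (hf : Measurable f) :
    IsExchangeable (Measure.infinitePi fun _ : ℕ => ν) (fun i x => f (x i)) := by
  intro σ _
  conv_rhs => rw [← Measure.map_infinitePi_infinitePi_of_inj (P := fun _ : ℕ => ν) σ.injective]
  rw [Measure.map_map (by fun_prop) (by fun_prop)]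
  rfl

theorem uniformLaw_mem_exchangeableLaws {m : ℕ} (hm : 1 ≤ m) :
    uniformLaw 3 m ∈ exchangeableLaws.{u} 3 := by
  have : NeZero m := ⟨by omega⟩
  let ν := uniformOn (Set.univ : Set (Fin m))
  have hf : Measurable fun a : Fin m => (a : ℝ) := measurable_of_finite _
  have key := lawNumDistinct_mem_exchangeableLaws.{u} (fun i => hf.comp (measurable_pi_apply i))
    (isExchangeable_infinitePi ν hf)
  convert key using 1
  have hmap : (Measure.infinitePi fun _ : ℕ => ν).map (fun x (i : Fin 3) => x i) =
      Measure.pi fun _ : Fin 3 => ν := by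
    rw [Measure.map_infinitePi_infinitePi_of_inj (P := fun _ : ℕ => ν) Fin.val_injective,
      Measure.infinitePi_eq_pi]
  ext k
  unfold uniformLaw lawNumDistinct
  rw [← hmap, map_measureReal_apply (by fun_prop) (Set.toFinite _).measurableSet]
  congr 1
  ext x
  -- Embedding the `m` points injectively into `ℝ` preserves the number of distinct values.
  have hinj : Function.Injective fun a : Fin m => (a : ℝ) :=
    Nat.cast_injective.comp Fin.val_injective
  have : numDistinct (fun i : Fin 3 => ((x i : Fin m) : ℝ)) = numDistinct fun i : Fin 3 => x i := by
    unfold numDistinct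
    rw [← Set.ncard_image_of_injective _ hinj, ← Set.range_comp]
    rfl
  simp [this]

/-- I.i.d. samples from an atomless law, here a Gaussian, almost surely never coincide: by Fubini
the diagonal is null. -/
theorem limitLaw_mem_exchangeableLaws : limitLaw 3 ∈ exchangeableLaws.{u} 3 := by
  let ν := gaussianReal 0 1
  have hν : NullSingletonClass ν := nullSingletonClass_gaussianReal one_ne_zero
  have he := isExchangeable_infinitePi ν measurable_id
  have hX : ∀ i, Measurable fun x : ℕ → ℝ => id (x i) := fun i => measurable_pi_apply i
  have key := lawNumDistinct_mem_exchangeableLaws.{u} hX he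
  have hs : (Measure.infinitePi fun _ : ℕ => ν).real {x | id (x 0) = id (x 1)} = 0 := by
    have hD : MeasurableSet {p : ℝ × ℝ | p.1 = p.2} := measurableSet_eq_fun (by fun_prop) (by fun_prop)
    have : (ν.prod ν) {p : ℝ × ℝ | p.1 = p.2} = 0 := by
      rw [Measure.measure_prod_null hD]
      refine Filter.Eventually.of_forall fun a => ?_
      have : Prod.mk a ⁻¹' {p : ℝ × ℝ | p.1 = p.2} = {a} := by
        ext b
        simp [eq_comm]
      exact (congrArg ν this).trans (measure_singleton a)
    rw [← Measure.infinitePi_map_eval_prod (P := fun _ : ℕ => ν) zero_ne_one,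
      Measure.map_apply (by fun_prop) hD] at this
    rw [measureReal_def]
    exact (congrArg ENNReal.toReal this).trans ENNReal.toReal_zero
  have ht : (Measure.infinitePi fun _ : ℕ => ν).real
      {x | id (x 0) = id (x 1) ∧ id (x 0) = id (x 2)} = 0 :=
    le_antisymm ((measureReal_mono fun x hx => hx.1).trans hs.le) measureReal_nonneg
  rw [he.lawNumDistinct_eq hX, hs, ht] at key
  rwa [limitLaw_three]

theorem theorem1 :
    (convexHull ℝ (lawVertices 3)).extremePoints ℝ = lawVertices 3 ∧
      exchangeableLaws.{u} 3 = convexHull ℝ (lawVertices 3) := by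
  refine ⟨extremePoints_convexHull_lawVertices, exchangeableLaws_subset.antisymm ?_⟩
  refine convexHull_min ?_ convex_exchangeableLaws
  rintro _ (⟨m, hm, rfl⟩ | rfl)
  · exact uniformLaw_mem_exchangeableLaws hm
  · exact limitLaw_mem_exchangeableLaws
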